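/- Let $D$ be a Prüfer domain (an integral domain such that $D_P$ is a valuation domain for every prime ideal $P$) with quotient field $K$. The \emph{inverse topology} on $\mathrm{Spec}(D)$ is the topology having as a subbasis the sets $V(I)=\{P\in\mathrm{Spec}(D)\mid I\subseteq P\}$, where $I$ ranges among the finitely generated ideals of $D$. A set $X\subseteq\mathrm{Spec}(D)$ is a \emph{splitting set} if it is closed under specialization (if $P\in X$ and $P\subseteq Q$ with $Q$ prime, then $Q\in X$) and open in the inverse topology; it is \emph{discrete} if $P\neq P^2$ for every $P\in X$. The \emph{support} of a fractional ideal $I$ of $D$ is $\mathrm{supp}(I)=\{P\in\mathrm{Spec}(D)\mid ID_P\neq D_P\}$, and $\mathrm{Inv}_X(D)$ is the group, under multiplication, of all invertible fractional ideals $I$ of $D$ with $\mathrm{supp}(I)\subseteq X$. A prime $M\in X$ is \emph{critical with respect to $X$} if there is no radical ideal $I$ of $D$ such that $I\in\mathrm{Inv}_X(D)$ and $I\subseteq M$. Let $X\subseteq\mathrm{Max}(D)$ be a discrete splitting set of $D$. If no $M\in X$ is critical with respect to $X$, then there is an isomorphism of groups $$\mathrm{Inv}_X(D)\simeq C_c(X,\mathbb{Z}),$$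 where $X$ carries the topology induced by the inverse topology of $\mathrm{Spec}(D)$, $\mathbb{Z}$ is discrete, and $C_c(X,\mathbb{Z})$ is the additive group, under pointwise addition, of the continuous functions $f:X\to\mathbb{Z}$ whose support (the closure in $X$ of $\{x\in X\mid f(x)\neq 0\}$) is compact. -/

import Mathlib

open scoped nonZeroDivisors CompactlySupported Topology

/-- A Prüfer domain: an integral domain that is locally a valuation domain. -/
def IsPruferDomain (D : Type*) [CommRing D] [IsDomain D] : Prop :=
  ∀ P : PrimeSpectrum D, ValuationRing (Localization.AtPrime P.asIdeal)

/-- The inverse topology on `Spec R`: the sets `V(I)`, for `I` a finitely generated ideal,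
form a subbasis. -/
abbrev inverseTopology (R : Type*) [CommRing R] : TopologicalSpace (PrimeSpectrum R) :=
  TopologicalSpace.generateFrom
    {s | ∃ I : Ideal R, I.FG ∧ s = PrimeSpectrum.zeroLocus (I : Set R)}

/-- The set `X ⊆ Spec R`, regarded as a type. It carries the topology induced by the inverse
topology of `Spec R`, not the one induced by the Zariski topology. -/
def InverseSubspace {R : Type*} [CommRing R] (X : Set (PrimeSpectrum R)) : Type _ :=
  {P : PrimeSpectrum R // P ∈ X}

instance {R : Type*} [CommRing R] (X : Set (PrimeSpectrum R)) :
    TopologicalSpace (InverseSubspace X) :=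
  TopologicalSpace.induced (fun P => P.1) (inverseTopology R)

/-- A splitting set of `D`: a set of primes that is closed under specialization and open in the
inverse topology. -/
structure IsSplittingSet {D : Type*} [CommRing D] (X : Set (PrimeSpectrum D)) : Prop where
  isUpperSet : IsUpperSet X
  isOpen_inverse : IsOpen[inverseTopology D] X

/-- A splitting set is discrete if it contains no idempotent prime ideal. -/
structure IsDiscreteSplittingSet {D : Type*} [CommRing D] (X : Set (PrimeSpectrum D)) : Prop
    extends IsSplittingSet X where
  not_idempotent : ∀ P ∈ X, P.asIdeal ≠ P.asIdeal ^ 2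

section Support

variable {D : Type*} (K : Type*) [CommRing D] [IsDomain D] [Field K] [Algebra D K]
  [IsFractionRing D K]

/-- The localization `D_P` of a domain at a prime, as a `D`-submodule of the quotient field. -/
noncomputable def localizationSubmodule (P : PrimeSpectrum D) : Submodule D K :=
  Subalgebra.toSubmodule (Localization.subalgebra.ofField K P.asIdeal.primeCompl
    P.asIdeal.primeCompl_le_nonZeroDivisors)

variable {K}

/-- The support of a fractional ideal `I`: the primes `P` with `I D_P ≠ D_P`. -/
def fractionalSupport (I : FractionalIdeal D⁰ K) : Set (PrimeSpectrum D) :=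
  {P | (I : Submodule D K) * localizationSubmodule K P ≠ localizationSubmodule K P}

theorem fractionalSupport_one : fractionalSupport (1 : FractionalIdeal D⁰ K) = ∅ := by
  ext P
  simp [fractionalSupport]

theorem fractionalSupport_mul (I J : FractionalIdeal D⁰ K) :
    fractionalSupport (I * J) ⊆ fractionalSupport I ∪ fractionalSupport J := by
  intro P hP
  by_contra h
  simp only [fractionalSupport, Set.mem_union, Set.mem_ofPred_eq, not_or, not_not] at h
  apply hP
  rw [FractionalIdeal.coe_mul, mul_assoc, h.2, h.1]

theorem fractionalSupport_inv (I : (FractionalIdeal D⁰ K)ˣ) :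
    fractionalSupport ((I⁻¹ : (FractionalIdeal D⁰ K)ˣ) : FractionalIdeal D⁰ K) ⊆
      fractionalSupport (I : FractionalIdeal D⁰ K) := by
  intro P hP h
  apply hP
  have h1 : (((I⁻¹ : (FractionalIdeal D⁰ K)ˣ) : FractionalIdeal D⁰ K) : Submodule D K) *
      ((I : FractionalIdeal D⁰ K) : Submodule D K) = 1 := by
    rw [← FractionalIdeal.coe_mul, Units.inv_mul, FractionalIdeal.coe_one]
  conv_lhs => rw [← h]
  rw [← mul_assoc, h1, one_mul]

variable (K)

/-- The group `Inv_X(D)` of the invertible fractional ideals whose support is contained in `X`,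
as a subgroup of the group `Inv(D)` of all invertible fractional ideals. -/
def invX (X : Set (PrimeSpectrum D)) : Subgroup (FractionalIdeal D⁰ K)ˣ where
  carrier := {I | fractionalSupport (I : FractionalIdeal D⁰ K) ⊆ X}
  one_mem' := by
    simp [fractionalSupport_one]
  mul_mem' := by
    intro I J hI hJ
    rw [Set.mem_ofPred_eq, Units.val_mul]
    exact (fractionalSupport_mul _ _).trans (Set.union_subset hI hJ)
  inv_mem' := by
    intro I hI
    exact (fractionalSupport_inv I).trans hI

/-- The set of the critical ideals with respect to `X`: the members `M` of `X` that contain no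
radical ideal of `D` belonging to `Inv_X(D)`. -/
def criticalSet (X : Set (PrimeSpectrum D)) : Set (PrimeSpectrum D) :=
  {M | M ∈ X ∧ ¬ ∃ I : Ideal D, I.IsRadical ∧ I ≤ M.asIdeal ∧
    ∃ u ∈ invX K X, (u : FractionalIdeal D⁰ K) = (I : FractionalIdeal D⁰ K)}

end Support

/-!
At each `M ∈ X` the localization `D_M` is a valuation ring whose maximal ideal is not idempotent,
hence generated by some `π_M`. The intersection `Q = ⋂ π_M ^ n D_M ∩ D` is a prime ideal strictly
below `M`, so it is not in `X` because `X` consists of maximal ideals. An invertible fractional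
ideal `u` with support in `X` is thus trivial at `Q`, and this forces `u D_M = π_M ^ n D_M` for a
unique integer `n` (`IsPruferDomain.exists_hasOrder`). Sending `u` to the function `M ↦ n` is a
homomorphism `ν` on `Inv_X(D)`. It is injective, since an invertible fractional ideal that is
trivial at every prime equals `D`.

If no `M ∈ X` is critical, there is a radical ideal `R ⊆ M` in `Inv_X(D)`, and its order is `1` on
all of `V(R)`. Comparing `u` with a power of `R` shows that `ν u` is locally constant at `M`
(`continuous_orderHom`). The support of `ν u` is the support of `u`, a Zariski closed set, which is
compact in the inverse topology (`isCompact_zeroLocus_inverseTopology`).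

For surjectivity, finitely generated ideals containing `R` are invertible and have order at most
`1`, so indicators of arbitrarily small neighbourhoods `V(I)` of `M` are in the range of `ν`
(`IsPruferDomain.exists_indicator_mem_range_orderHom`). The range is closed under pointwise minima,
since sums of invertible fractional ideals of `D` are invertible and the order of a sum is the
minimum of the orders. A group of functions with these two properties contains every continuous
function with compact support (`AddSubgroup.mem_of_hasCompactSupport`).

Divisibility in `D_M` is expressed throughout by elements of `D`, with denominators in `D \ M`
cleared.
-/

/-! ### Prüfer domains -/

section Prufer

variable {D : Type*} [CommRing D] [IsDomain D]

/-- In a Prüfer domain divisibility is locally a total relation, here with the denominators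
cleared. -/
theorem IsPruferDomain.exists_dvd_or_dvd (hD : IsPruferDomain D) (P : PrimeSpectrum D) (a b : D) :
    ∃ s ∉ P.asIdeal, a ∣ s * b ∨ b ∣ s * a := by
  have key : ∀ x y : D,
      algebraMap D (Localization.AtPrime P.asIdeal) x ∣ algebraMap D _ y →
        ∃ s ∉ P.asIdeal, x ∣ s * y := by
    rintro x y ⟨z, hz⟩
    obtain ⟨⟨c, t⟩, hct⟩ := IsLocalization.surj P.asIdeal.primeCompl z
    refine ⟨t, t.2, c, ?_⟩
    apply IsLocalization.injective (Localization.AtPrime P.asIdeal)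
      P.asIdeal.primeCompl_le_nonZeroDivisors
    rw [map_mul, map_mul, hz, ← hct]
    ring
  have := hD P
  rcases ValuationRing.dvd_total (algebraMap D (Localization.AtPrime P.asIdeal) a)
    (algebraMap D _ b) with h | h
  · obtain ⟨s, hs, h⟩ := key a b h
    exact ⟨s, hs, Or.inl h⟩
  · obtain ⟨s, hs, h⟩ := key b a h
    exact ⟨s, hs, Or.inr h⟩

/-- A nonzero element `π` of `D` generating the maximal ideal of `D_M`: every element of `M` is
divisible by `π` up to a factor outside `M`. -/
structure IsLocalUniformizer (M : PrimeSpectrum D) (π : D) : Prop where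
  ne_zero : π ≠ 0
  mem : π ∈ M.asIdeal
  exists_dvd : ∀ c ∈ M.asIdeal, ∃ s ∉ M.asIdeal, π ∣ s * c

/-- Every element of `M` outside `M²` generates the maximal ideal of the valuation ring `D_M`. -/
theorem IsPruferDomain.exists_isLocalUniformizer (hD : IsPruferDomain D) {M : PrimeSpectrum D}
    (hM : M.asIdeal.IsMaximal) (hidem : M.asIdeal ≠ M.asIdeal ^ 2) :
    ∃ π, IsLocalUniformizer M π := by
  obtain ⟨π, hπ, hπ2⟩ : ∃ π ∈ M.asIdeal, π ∉ M.asIdeal ^ 2 :=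
    SetLike.not_le_iff_exists.mp fun h => hidem (le_antisymm h (Ideal.pow_le_self two_ne_zero))
  refine ⟨π, fun h => hπ2 (h ▸ zero_mem _), hπ, fun c hc => ?_⟩
  obtain ⟨s, hs, h | ⟨d, hd⟩⟩ := hD.exists_dvd_or_dvd M π c
  · exact ⟨s, hs, h⟩
  · refine ⟨d, fun hdM => hπ2 ?_, s, by linear_combination -hd⟩
    -- Otherwise `s * π ∈ M²` with `s ∉ M`, and `s` is invertible modulo `M`.
    have hsπ : s * π ∈ M.asIdeal ^ 2 := by
      rw [hd, pow_two]
      exact Ideal.mul_mem_mul hc hdM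
    obtain ⟨r, m, hm, hrm⟩ := hM.exists_inv hs
    have h1 : π = r * (s * π) + m * π := by linear_combination -π * hrm
    rw [h1]
    refine add_mem (Ideal.mul_mem_left _ _ hsπ) ?_
    rw [pow_two]
    exact Ideal.mul_mem_mul hm hπ

variable {K : Type*} [Field K] [Algebra D K] [IsFractionRing D K]

/-- Locally, one of finitely many elements of the quotient field divides all the others. -/
theorem IsPruferDomain.exists_forall_smul_eq (hD : IsPruferDomain D) (P : PrimeSpectrum D)
    (S : Finset K) (hS : S.Nonempty) :
    ∃ a ∈ S, ∃ s ∉ P.asIdeal, ∀ b ∈ S, ∃ d : D, s • b = d • a := by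
  classical
  induction hS using Finset.Nonempty.cons_induction with
  | singleton a =>
    refine ⟨a, by simp, 1, P.2.one_notMem, fun b hb => ⟨1, ?_⟩⟩
    rw [Finset.mem_singleton.mp hb]
  | cons c S hc hS ih =>
    obtain ⟨a, ha, s, hs, h⟩ := ih
    obtain ⟨q, hq⟩ := IsLocalization.exist_integer_multiples_of_finset D⁰ ({a, c} : Finset K)
    obtain ⟨a', ha'⟩ := hq a (by simp)
    obtain ⟨c', hc'⟩ := hq c (by simp)
    have hq0 : algebraMap D K q ≠ 0 := by simp
    rw [Algebra.smul_def] at ha' hc'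
    obtain ⟨t, ht, ⟨d, hd⟩ | ⟨d, hd⟩⟩ := hD.exists_dvd_or_dvd P a' c'
    · refine ⟨a, by simp [ha], s * t, P.asIdeal.primeCompl.mul_mem hs ht, fun b hb => ?_⟩
      rcases Finset.mem_cons.mp hb with rfl | hb
      · refine ⟨s * d, ?_⟩
        have hd' := congrArg (algebraMap D K) hd
        simp only [map_mul, ha', hc', Algebra.smul_def] at hd' ⊢
        refine mul_left_cancel₀ hq0 ?_
        linear_combination algebraMap D K s * hd'
      · obtain ⟨e, he⟩ := h b hb
        refine ⟨t * e, ?_⟩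
        simp only [map_mul, Algebra.smul_def] at he ⊢
        linear_combination algebraMap D K t * he
    · have hca : t • a = d • c := by
        have hd' := congrArg (algebraMap D K) hd
        simp only [map_mul, ha', hc', Algebra.smul_def] at hd' ⊢
        refine mul_left_cancel₀ hq0 ?_
        linear_combination hd'
      refine ⟨c, by simp, s * t, P.asIdeal.primeCompl.mul_mem hs ht, fun b hb => ?_⟩
      rcases Finset.mem_cons.mp hb with rfl | hb
      · exact ⟨s * t, rfl⟩
      · obtain ⟨e, he⟩ := h b hb
        refine ⟨e * d, ?_⟩
        simp only [map_mul, Algebra.smul_def] at he hca ⊢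
        linear_combination algebraMap D K t * he + algebraMap D K e * hca

/-- Nonzero finitely generated fractional ideals of a Prüfer domain are invertible, because they
are locally principal. -/
theorem IsPruferDomain.isUnit_of_fg (hD : IsPruferDomain D) {I : FractionalIdeal D⁰ K}
    (h0 : I ≠ 0) (hfg : (I : Submodule D K).FG) : IsUnit I := by
  rw [← FractionalIdeal.mul_inv_cancel_iff_isUnit]
  have hle : I * I⁻¹ ≤ 1 := FractionalIdeal.mul_one_div_le_one
  obtain ⟨A, hA⟩ := FractionalIdeal.le_one_iff_exists_coeIdeal.mp hle
  rw [← hA]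
  by_contra hne
  have hAtop : A ≠ ⊤ := fun h => hne (by rw [h, FractionalIdeal.coeIdeal_top])
  obtain ⟨M, hM, hAM⟩ := A.exists_le_maximal hAtop
  obtain ⟨S, hS⟩ := hfg
  have hSne : S.Nonempty := by
    rw [Finset.nonempty_iff_ne_empty]
    rintro rfl
    exact h0 (FractionalIdeal.coeToSubmodule_injective (by simpa using hS.symm))
  obtain ⟨a, ha, s, hs, h⟩ := hD.exists_forall_smul_eq ⟨M, hM.isPrime⟩ S hSne
  have hmem : ∀ y ∈ I, ∃ d : D, s • y = d • a := by
    intro y hy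
    replace hy : y ∈ Submodule.span D (S : Set K) := by rw [hS]; exact hy
    induction hy using Submodule.span_induction with
    | mem x hx => exact h x hx
    | zero => exact ⟨0, by simp⟩
    | add x y _ _ h1 h2 =>
      obtain ⟨d, hd⟩ := h1
      obtain ⟨e, he⟩ := h2
      exact ⟨d + e, by rw [smul_add, add_smul, hd, he]⟩
    | smul r x _ h1 =>
      obtain ⟨d, hd⟩ := h1
      exact ⟨r * d, by rw [smul_comm, hd, mul_smul]⟩
  have haI : a ∈ I := by
    have : a ∈ (I : Submodule D K) := hS ▸ Submodule.subset_span ha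
    exact this
  have hs0 : algebraMap D K s ≠ 0 := by
    simp only [ne_eq, FaithfulSMul.algebraMap_eq_zero_iff]
    rintro rfl
    exact hs (zero_mem _)
  have ha0 : a ≠ 0 := by
    rintro rfl
    refine h0 (FractionalIdeal.eq_zero_iff.mpr fun y hy => ?_)
    obtain ⟨d, hd⟩ := hmem y hy
    rw [smul_zero, Algebra.smul_def] at hd
    exact (mul_eq_zero.mp hd).resolve_left hs0
  have hinv : algebraMap D K s * a⁻¹ ∈ I⁻¹ := by
    rw [FractionalIdeal.mem_inv_iff h0]
    intro y hy
    obtain ⟨d, hd⟩ := hmem y hy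
    rw [FractionalIdeal.mem_one_iff]
    refine ⟨d, ?_⟩
    rw [Algebra.smul_def, Algebra.smul_def] at hd
    field_simp
    exact hd.symm
  have hsA : algebraMap D K s ∈ (A : FractionalIdeal D⁰ K) := by
    rw [hA]
    have := FractionalIdeal.mul_mem_mul haI hinv
    rwa [mul_left_comm, mul_inv_cancel₀ ha0, mul_one] at this
  obtain ⟨s', hs', hss'⟩ := (FractionalIdeal.mem_coeIdeal _).mp hsA
  rw [IsFractionRing.injective D K hss'] at hs'
  exact hs (hAM hs')

theorem IsPruferDomain.isUnit_add (hD : IsPruferDomain D) (u v : (FractionalIdeal D⁰ K)ˣ) :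
    IsUnit ((u : FractionalIdeal D⁰ K) + v) := by
  refine hD.isUnit_of_fg ?_ ?_
  · intro h
    have : (u : FractionalIdeal D⁰ K) ≤ 0 := h ▸ le_self_add
    exact u.ne_zero (le_antisymm this zero_le)
  · rw [FractionalIdeal.coe_add]
    exact (FractionalIdeal.fg_unit u).sup (FractionalIdeal.fg_unit v)

end Prufer

/-! ### Membership in invertible fractional ideals and their supports -/

section Units

variable {D K : Type*} [CommRing D] [Field K] [Algebra D K]

theorem FractionalIdeal.exists_algebraMap_eq_mul (u : (FractionalIdeal D⁰ K)ˣ) {x y : K}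
    (hx : x ∈ (u : FractionalIdeal D⁰ K))
    (hy : y ∈ ((u⁻¹ : (FractionalIdeal D⁰ K)ˣ) : FractionalIdeal D⁰ K)) :
    ∃ d : D, algebraMap D K d = x * y := by
  have := FractionalIdeal.mul_mem_mul hx hy
  rwa [Units.mul_inv, FractionalIdeal.mem_one_iff] at this

theorem FractionalIdeal.algebraMap_mul_mem {I : FractionalIdeal D⁰ K} (d : D) {x : K}
    (hx : x ∈ I) : algebraMap D K d * x ∈ I := by
  rw [← Algebra.smul_def]
  exact Submodule.smul_mem (I : Submodule D K) d hx

variable [IsFractionRing D K]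

theorem algebraMap_ne_zero_of_notMem {P : PrimeSpectrum D} {s : D} (hs : s ∉ P.asIdeal) :
    algebraMap D K s ≠ 0 := by
  simp only [ne_eq, FaithfulSMul.algebraMap_eq_zero_iff]
  rintro rfl
  exact hs (zero_mem _)

/-- At each prime, an invertible fractional ideal has a local generator `a`, with an
element `b` of the inverse such that `a * b` is a local unit. -/
theorem FractionalIdeal.exists_mul_eq_algebraMap (u : (FractionalIdeal D⁰ K)ˣ)
    (P : PrimeSpectrum D) :
    ∃ a ∈ (u : FractionalIdeal D⁰ K),
      ∃ b ∈ ((u⁻¹ : (FractionalIdeal D⁰ K)ˣ) : FractionalIdeal D⁰ K),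
        ∃ s ∉ P.asIdeal, a * b = algebraMap D K s := by
  by_contra! h
  have hle : (u : FractionalIdeal D⁰ K) * (u⁻¹ : (FractionalIdeal D⁰ K)ˣ) ≤
      (P.asIdeal : FractionalIdeal D⁰ K) := by
    rw [FractionalIdeal.mul_le]
    intro a ha b hb
    obtain ⟨d, hd⟩ := FractionalIdeal.exists_algebraMap_eq_mul u ha hb
    rw [← hd]
    refine FractionalIdeal.mem_coeIdeal_of_mem _ ?_
    by_contra hdP
    exact h a ha b hb d hdP hd.symm
  rw [Units.mul_inv] at hle
  have h1 : algebraMap D K 1 ∈ (P.asIdeal : FractionalIdeal D⁰ K) := by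
    rw [map_one]
    exact hle (FractionalIdeal.one_mem_one _)
  obtain ⟨d, hd, hd1⟩ := (FractionalIdeal.mem_coeIdeal _).mp h1
  rw [IsFractionRing.injective D K hd1] at hd
  exact P.2.one_notMem hd

variable [IsDomain D]


theorem FractionalIdeal.mem_units_inv_iff (u : (FractionalIdeal D⁰ K)ˣ) {x : K} :
    x ∈ ((u⁻¹ : (FractionalIdeal D⁰ K)ˣ) : FractionalIdeal D⁰ K) ↔
      ∀ y ∈ (u : FractionalIdeal D⁰ K), ∃ d : D, algebraMap D K d = x * y := by
  rw [FractionalIdeal.right_inverse_eq K _ _ u.mul_inv, FractionalIdeal.mem_inv_iff u.ne_zero]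
  simp only [FractionalIdeal.mem_one_iff]

theorem mem_localizationSubmodule_iff {P : PrimeSpectrum D} {x : K} :
    x ∈ localizationSubmodule K P ↔
      ∃ a, ∃ s ∉ P.asIdeal, x = algebraMap D K a * (algebraMap D K s)⁻¹ := by
  have : x ∈ localizationSubmodule K P ↔ x ∈ {x : K | ∃ (a s : D) (_ : s ∈ P.asIdeal.primeCompl),
      x = algebraMap D K a * (algebraMap D K s)⁻¹} := Iff.rfl
  rw [this]
  simp [Ideal.primeCompl]

/-- An invertible fractional ideal `u` is trivial at `P` exactly if both `u` and `u⁻¹` contain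
elements of `D` outside `P`. -/
theorem notMem_fractionalSupport_iff (u : (FractionalIdeal D⁰ K)ˣ) (P : PrimeSpectrum D) :
    P ∉ fractionalSupport (u : FractionalIdeal D⁰ K) ↔
      (∃ s ∉ P.asIdeal, algebraMap D K s ∈ (u : FractionalIdeal D⁰ K)) ∧
      ∃ s ∉ P.asIdeal,
        algebraMap D K s ∈ ((u⁻¹ : (FractionalIdeal D⁰ K)ˣ) : FractionalIdeal D⁰ K) := by
  have one_mem : (1 : K) ∈ localizationSubmodule K P :=
    mem_localizationSubmodule_iff.mpr ⟨1, 1, P.2.one_notMem, by simp⟩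
  constructor
  · have key : ∀ v : (FractionalIdeal D⁰ K)ˣ,
        P ∉ fractionalSupport (v : FractionalIdeal D⁰ K) →
          ∃ s ∉ P.asIdeal, algebraMap D K s ∈ (v : FractionalIdeal D⁰ K) := by
      intro v hv
      have hv' : ((v : FractionalIdeal D⁰ K) : Submodule D K) * localizationSubmodule K P =
        localizationSubmodule K P := not_not.mp hv
      rw [← hv'] at one_mem
      suffices h : ∀ y ∈ ((v : FractionalIdeal D⁰ K) : Submodule D K) *
          localizationSubmodule K P, ∃ s ∉ P.asIdeal,
            algebraMap D K s * y ∈ (v : FractionalIdeal D⁰ K) by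
        simpa using h 1 one_mem
      intro y hy
      induction hy using Submodule.mul_induction_on' with
      | mem_mul_mem m hm n hn =>
        obtain ⟨a, s, hs, rfl⟩ := mem_localizationSubmodule_iff.mp hn
        refine ⟨s, hs, ?_⟩
        have hs0 : algebraMap D K s ≠ 0 := algebraMap_ne_zero_of_notMem hs
        convert FractionalIdeal.algebraMap_mul_mem a hm using 1
        field_simp
      | add x hx y hy h1 h2 =>
        obtain ⟨s, hs, h1⟩ := h1
        obtain ⟨t, ht, h2⟩ := h2
        refine ⟨s * t, P.asIdeal.primeCompl.mul_mem hs ht, ?_⟩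
        have heq : algebraMap D K (s * t) * (x + y) = algebraMap D K t * (algebraMap D K s * x) +
            algebraMap D K s * (algebraMap D K t * y) := by
          rw [map_mul]
          ring
        rw [heq]
        exact Submodule.add_mem ((v : FractionalIdeal D⁰ K) : Submodule D K)
          (FractionalIdeal.algebraMap_mul_mem t h1) (FractionalIdeal.algebraMap_mul_mem s h2)
    exact fun h => ⟨key u h, key u⁻¹ fun h' => h (fractionalSupport_inv u h')⟩
  · rintro ⟨⟨s, hs, hsu⟩, t, ht, htu⟩
    refine not_not.mpr (le_antisymm ?_ ?_)
    · rw [Submodule.mul_le]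
      intro m hm n hn
      obtain ⟨a, r, hr, rfl⟩ := mem_localizationSubmodule_iff.mp hn
      obtain ⟨d, hd⟩ := FractionalIdeal.exists_algebraMap_eq_mul u hm htu
      refine mem_localizationSubmodule_iff.mpr
        ⟨a * d, t * r, P.asIdeal.primeCompl.mul_mem ht hr, ?_⟩
      have ht0 : algebraMap D K t ≠ 0 := algebraMap_ne_zero_of_notMem ht
      have hr0 : algebraMap D K r ≠ 0 := algebraMap_ne_zero_of_notMem hr
      rw [map_mul, map_mul, hd]
      field_simp
    · intro n hn
      obtain ⟨a, r, hr, rfl⟩ := mem_localizationSubmodule_iff.mp hn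
      have hs0 : algebraMap D K s ≠ 0 := algebraMap_ne_zero_of_notMem hs
      have hr0 : algebraMap D K r ≠ 0 := algebraMap_ne_zero_of_notMem hr
      have : algebraMap D K a * (algebraMap D K r)⁻¹ =
          algebraMap D K s * (algebraMap D K a * (algebraMap D K (s * r))⁻¹) := by
        rw [map_mul]
        field_simp
      rw [this]
      exact Submodule.mul_mem_mul hsu (mem_localizationSubmodule_iff.mpr
        ⟨a, s * r, P.asIdeal.primeCompl.mul_mem hs hr, rfl⟩)

theorem one_mem_of_fractionalSupport_eq_empty {u : (FractionalIdeal D⁰ K)ˣ}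
    (hu : fractionalSupport (u : FractionalIdeal D⁰ K) = ∅) :
    (1 : K) ∈ (u : FractionalIdeal D⁰ K) := by
  let A : Ideal D := Submodule.comap (Algebra.linearMap D K)
    ((u : FractionalIdeal D⁰ K) : Submodule D K)
  have hA : A = ⊤ := by
    by_contra hA
    obtain ⟨M, hM, hAM⟩ := A.exists_le_maximal hA
    have hnot : (⟨M, hM.isPrime⟩ : PrimeSpectrum D) ∉
        fractionalSupport (u : FractionalIdeal D⁰ K) := by simp [hu]
    obtain ⟨⟨s, hs, hsu⟩, -⟩ := (notMem_fractionalSupport_iff u _).mp hnot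
    exact hs (hAM hsu)
  have h1 : (1 : D) ∈ A := hA ▸ Submodule.mem_top
  have : algebraMap D K 1 ∈ (u : FractionalIdeal D⁰ K) := h1
  rwa [map_one] at this

theorem eq_one_of_fractionalSupport_eq_empty {u : (FractionalIdeal D⁰ K)ˣ}
    (hu : fractionalSupport (u : FractionalIdeal D⁰ K) = ∅) : u = 1 := by
  have h1 := one_mem_of_fractionalSupport_eq_empty hu
  have h2 := one_mem_of_fractionalSupport_eq_empty (u := u⁻¹)
    (Set.subset_empty_iff.mp (hu ▸ fractionalSupport_inv u))
  refine Units.ext (le_antisymm (fun y hy => ?_) ?_)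
  · obtain ⟨d, hd⟩ := FractionalIdeal.exists_algebraMap_eq_mul u hy h2
    rw [mul_one] at hd
    exact (FractionalIdeal.mem_one_iff _).mpr ⟨d, hd⟩
  · exact FractionalIdeal.one_le.mpr h1

theorem fractionalSupport_add_subset {u v w : (FractionalIdeal D⁰ K)ˣ}
    (hw : (w : FractionalIdeal D⁰ K) = u + v) :
    fractionalSupport (w : FractionalIdeal D⁰ K) ⊆
      fractionalSupport (u : FractionalIdeal D⁰ K) ∪
        fractionalSupport (v : FractionalIdeal D⁰ K) := by
  intro P hP
  by_contra h
  rw [Set.mem_union, not_or, notMem_fractionalSupport_iff, notMem_fractionalSupport_iff] at h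
  obtain ⟨⟨⟨s, hs, hsu⟩, s', hs', hsu'⟩, -, t', ht', htv'⟩ := h
  refine (notMem_fractionalSupport_iff w P).mpr ⟨⟨s, hs, ?_⟩, s' * t',
    P.asIdeal.primeCompl.mul_mem hs' ht', ?_⟩ hP
  · rw [hw]
    exact (le_self_add : (u : FractionalIdeal D⁰ K) ≤ u + v) hsu
  · rw [FractionalIdeal.mem_units_inv_iff, hw]
    intro y hy
    obtain ⟨a, ha, b, hb, rfl⟩ := (FractionalIdeal.mem_add _ _ _).mp hy
    obtain ⟨d, hd⟩ := FractionalIdeal.exists_algebraMap_eq_mul u ha hsu'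
    obtain ⟨e, he⟩ := FractionalIdeal.exists_algebraMap_eq_mul v hb htv'
    refine ⟨t' * d + s' * e, ?_⟩
    simp only [map_add, map_mul, hd, he]
    ring

end Units

/-! ### The order of an invertible fractional ideal at a prime with a local uniformizer -/

section Order

variable {D K : Type*} [CommRing D]

/-- The elements of `D` lying in `π ^ n D_M` for every `n`. -/
def infinitelyDivisible (M : PrimeSpectrum D) (π : D) : Ideal D where
  carrier := {d | ∀ n : ℕ, ∃ t ∉ M.asIdeal, π ^ n ∣ t * d}
  zero_mem' n := ⟨1, M.2.one_notMem, by simp⟩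
  add_mem' := by
    intro x y hx hy n
    obtain ⟨t, ht, hx⟩ := hx n
    obtain ⟨s, hs, hy⟩ := hy n
    refine ⟨t * s, M.asIdeal.primeCompl.mul_mem ht hs, ?_⟩
    have : t * s * (x + y) = s * (t * x) + t * (s * y) := by ring
    rw [this]
    exact dvd_add (Dvd.dvd.mul_left hx _) (Dvd.dvd.mul_left hy _)
  smul_mem' := by
    intro c x hx n
    obtain ⟨t, ht, hx⟩ := hx n
    refine ⟨t, ht, ?_⟩
    rw [smul_eq_mul, mul_left_comm]
    exact Dvd.dvd.mul_left hx _

/-- An element of `D` outside `⋂ π ^ n D_M` is a power of `π` up to a unit of `D_M`. -/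
theorem IsLocalUniformizer.exists_eq_pow_mul {M : PrimeSpectrum D} {π : D}
    (hπ : IsLocalUniformizer M π) {d : D} (hd : d ∉ infinitelyDivisible M π) :
    ∃ n : ℕ, ∃ t ∉ M.asIdeal, ∃ e ∉ M.asIdeal, t * d = π ^ n * e := by
  classical
  have hd' : ∃ n : ℕ, ¬ ∃ t ∉ M.asIdeal, π ^ n ∣ t * d := not_forall.mp hd
  obtain ⟨n, hn, hmin⟩ : ∃ n : ℕ, (¬ ∃ t ∉ M.asIdeal, π ^ n ∣ t * d) ∧
      ∀ m < n, ∃ t ∉ M.asIdeal, π ^ m ∣ t * d :=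
    ⟨Nat.find hd', Nat.find_spec hd', fun m hm => not_not.mp (Nat.find_min hd' hm)⟩
  cases n with
  | zero => exact absurd ⟨1, M.2.one_notMem, by simp⟩ hn
  | succ m =>
    obtain ⟨t, ht, e, he⟩ := hmin m m.lt_succ_self
    refine ⟨m, t, ht, e, fun heM => hn ?_, he⟩
    obtain ⟨s, hs, f, hf⟩ := hπ.exists_dvd e heM
    exact ⟨s * t, M.asIdeal.primeCompl.mul_mem hs ht, f,
      by linear_combination s * he + π ^ m * hf⟩

theorem IsLocalUniformizer.infinitelyDivisible_le {M : PrimeSpectrum D} {π : D}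
    (hπ : IsLocalUniformizer M π) : infinitelyDivisible M π ≤ M.asIdeal := by
  intro d hd
  obtain ⟨t, ht, f, hf⟩ := hd 1
  refine (M.2.mem_or_mem ?_).resolve_left ht
  rw [hf, pow_one]
  exact Ideal.mul_mem_right _ _ hπ.mem

theorem IsLocalUniformizer.notMem_infinitelyDivisible [IsDomain D] {M : PrimeSpectrum D} {π : D}
    (hπ : IsLocalUniformizer M π) : π ∉ infinitelyDivisible M π := by
  intro h
  obtain ⟨t, ht, f, hf⟩ := h 2
  have : t = π * f := mul_left_cancel₀ hπ.ne_zero (by linear_combination hf)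
  exact ht (this ▸ Ideal.mul_mem_right _ _ hπ.mem)

theorem IsLocalUniformizer.isPrime_infinitelyDivisible [IsDomain D] {M : PrimeSpectrum D}
    {π : D} (hπ : IsLocalUniformizer M π) : (infinitelyDivisible M π).IsPrime where
  ne_top' h := M.2.one_notMem (hπ.infinitelyDivisible_le (h ▸ Submodule.mem_top))
  mem_or_mem' := by
    intro x y hxy
    by_contra! h
    obtain ⟨m, t, ht, e, he, h1⟩ := hπ.exists_eq_pow_mul h.1
    obtain ⟨k, t', ht', e', he', h2⟩ := hπ.exists_eq_pow_mul h.2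
    obtain ⟨r, hr, f, hf⟩ := hxy (m + k + 1)
    have h3 : r * (e * e') = π * (f * t * t') := by
      refine mul_left_cancel₀ (pow_ne_zero (m + k) hπ.ne_zero) ?_
      linear_combination (t * t') * hf - (r * t' * y) * h1 - (r * π ^ m * e) * h2
    have h4 : r * (e * e') ∉ M.asIdeal :=
      M.asIdeal.primeCompl.mul_mem hr (M.asIdeal.primeCompl.mul_mem he he')
    exact h4 (h3 ▸ Ideal.mul_mem_right _ _ hπ.mem)

variable [Field K] [Algebra D K]

/-- The invertible fractional ideal `u` satisfies `u D_M = π ^ n D_M`. This is expressed by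
elements: up to a factor in `D \ M`, `π ^ n` belongs to `u` and `π ^ (-n)` belongs to `u⁻¹`. -/
def HasOrder (M : PrimeSpectrum D) (π : D) (u : (FractionalIdeal D⁰ K)ˣ) (n : ℤ) : Prop :=
  (∃ s ∉ M.asIdeal, algebraMap D K s * algebraMap D K π ^ n ∈ (u : FractionalIdeal D⁰ K)) ∧
  ∃ s ∉ M.asIdeal, algebraMap D K s * algebraMap D K π ^ (-n) ∈
    ((u⁻¹ : (FractionalIdeal D⁰ K)ˣ) : FractionalIdeal D⁰ K)

variable {M : PrimeSpectrum D} {π : D} {u v w : (FractionalIdeal D⁰ K)ˣ} {m n : ℤ}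

theorem HasOrder.inv (h : HasOrder M π u n) : HasOrder M π u⁻¹ (-n) :=
  ⟨h.2, by simpa using h.1⟩

variable [IsFractionRing D K]

theorem IsLocalUniformizer.algebraMap_ne_zero (hπ : IsLocalUniformizer M π) :
    algebraMap D K π ≠ 0 := by
  simpa using hπ.ne_zero

theorem hasOrder_zero_iff [IsDomain D] :
    HasOrder M π u 0 ↔ M ∉ fractionalSupport (u : FractionalIdeal D⁰ K) := by
  simp [HasOrder, notMem_fractionalSupport_iff]

theorem HasOrder.mul (hπ : IsLocalUniformizer M π) (hu : HasOrder M π u m)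
    (hv : HasOrder M π v n) : HasOrder M π (u * v) (m + n) := by
  obtain ⟨⟨s, hs, hsu⟩, s', hs', hsu'⟩ := hu
  obtain ⟨⟨t, ht, htv⟩, t', ht', htv'⟩ := hv
  refine ⟨⟨s * t, M.asIdeal.primeCompl.mul_mem hs ht, ?_⟩,
    s' * t', M.asIdeal.primeCompl.mul_mem hs' ht', ?_⟩
  · rw [Units.val_mul]
    convert FractionalIdeal.mul_mem_mul hsu htv using 1
    rw [map_mul, zpow_add₀ hπ.algebraMap_ne_zero]
    ring
  · rw [mul_inv, Units.val_mul]
    convert FractionalIdeal.mul_mem_mul hsu' htv' using 1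
    rw [map_mul, neg_add, zpow_add₀ hπ.algebraMap_ne_zero]
    ring

theorem HasOrder.le (hπ : IsLocalUniformizer M π) (hn : HasOrder M π u n)
    (hm : HasOrder M π u m) : n ≤ m := by
  by_contra! hlt
  obtain ⟨k, rfl⟩ := Int.exists_add_of_le (Int.add_one_le_of_lt hlt)
  obtain ⟨s, hs, hsu⟩ := hm.1
  obtain ⟨t, ht, htu⟩ := hn.2
  obtain ⟨d, hd⟩ := FractionalIdeal.exists_algebraMap_eq_mul u hsu htu
  have hπ0 : algebraMap D K π ≠ 0 := hπ.algebraMap_ne_zero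
  have h1 : s * t = π * (π ^ k * d) := by
    apply IsFractionRing.injective D K
    simp only [map_mul, map_pow, hd]
    rw [zpow_neg, zpow_add₀ hπ0, zpow_add₀ hπ0, zpow_one, zpow_natCast]
    have := zpow_ne_zero m hπ0
    field_simp
  have h2 : s * t ∉ M.asIdeal := M.asIdeal.primeCompl.mul_mem hs ht
  exact h2 (h1 ▸ Ideal.mul_mem_right _ _ hπ.mem)

theorem HasOrder.unique (hπ : IsLocalUniformizer M π) (hn : HasOrder M π u n)
    (hm : HasOrder M π u m) : n = m :=
  le_antisymm (hn.le hπ hm) (hm.le hπ hn)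

theorem HasOrder.add_of_le [IsDomain D] (hπ : IsLocalUniformizer M π)
    (hu : HasOrder M π u m) (hv : HasOrder M π v n) (hw : (w : FractionalIdeal D⁰ K) = u + v)
    (hmn : m ≤ n) :
    HasOrder M π w m := by
  obtain ⟨k, rfl⟩ := Int.exists_add_of_le hmn
  obtain ⟨⟨s, hs, hsu⟩, s', hs', hsu'⟩ := hu
  obtain ⟨t', ht', htv'⟩ := hv.2
  refine ⟨⟨s, hs, ?_⟩, s' * t', M.asIdeal.primeCompl.mul_mem hs' ht', ?_⟩
  · rw [hw]
    exact (le_self_add : (u : FractionalIdeal D⁰ K) ≤ u + v) hsu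
  · rw [FractionalIdeal.mem_units_inv_iff, hw]
    intro y hy
    obtain ⟨a, ha, b, hb, rfl⟩ := (FractionalIdeal.mem_add _ _ _).mp hy
    obtain ⟨d, hd⟩ := FractionalIdeal.exists_algebraMap_eq_mul u ha hsu'
    obtain ⟨e, he⟩ := FractionalIdeal.exists_algebraMap_eq_mul v hb htv'
    refine ⟨t' * d + s' * e * π ^ k, ?_⟩
    have hπ0 : algebraMap D K π ≠ 0 := hπ.algebraMap_ne_zero
    simp only [map_add, map_mul, map_pow, hd, he]
    rw [zpow_neg, zpow_neg, zpow_add₀ hπ0, zpow_natCast]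
    have := zpow_ne_zero m hπ0
    field_simp

theorem HasOrder.add [IsDomain D] (hπ : IsLocalUniformizer M π) (hu : HasOrder M π u m)
    (hv : HasOrder M π v n) (hw : (w : FractionalIdeal D⁰ K) = u + v) :
    HasOrder M π w (min m n) := by
  rcases le_total m n with h | h
  · rw [min_eq_left h]
    exact hu.add_of_le hπ hv hw h
  · rw [min_eq_right h]
    exact hv.add_of_le hπ hu (by rw [hw, add_comm]) h

/-- If the local generator `c` of `u` lies in `D`, then `u` has an order: otherwise `c` would lie
in the prime ideal `⋂ π ^ n D_M ∩ D`, which is strictly below `M` and hence outside the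
support of `u`. -/
theorem exists_hasOrder_of_algebraMap_mem [IsDomain D] (hπ : IsLocalUniformizer M π)
    (hu : ∀ P < M, P ∉ fractionalSupport (u : FractionalIdeal D⁰ K)) {c s : D} {b : K}
    (hc : algebraMap D K c ∈ (u : FractionalIdeal D⁰ K))
    (hb : b ∈ ((u⁻¹ : (FractionalIdeal D⁰ K)ˣ) : FractionalIdeal D⁰ K))
    (hs : s ∉ M.asIdeal) (hcb : algebraMap D K c * b = algebraMap D K s) :
    ∃ n, HasOrder M π u n := by
  have hcQ : c ∉ infinitelyDivisible M π := by
    intro hcQ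
    have hQlt : (⟨infinitelyDivisible M π, hπ.isPrime_infinitelyDivisible⟩ : PrimeSpectrum D)
        < M :=
      lt_of_le_of_ne hπ.infinitelyDivisible_le fun h =>
        hπ.notMem_infinitelyDivisible
          ((congrArg PrimeSpectrum.asIdeal h).ge hπ.mem)
    obtain ⟨⟨t, ht, htu⟩, -⟩ := (notMem_fractionalSupport_iff u _).mp (hu _ hQlt)
    obtain ⟨d, hd⟩ := FractionalIdeal.exists_algebraMap_eq_mul u htu hb
    have h1 : c * d = s * t := by
      apply IsFractionRing.injective D K
      rw [map_mul, map_mul, hd, ← hcb]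
      ring
    have h2 : s * t ∈ infinitelyDivisible M π := h1 ▸ Ideal.mul_mem_right _ _ hcQ
    rcases hπ.isPrime_infinitelyDivisible.mem_or_mem h2 with h | h
    · exact hs (hπ.infinitelyDivisible_le h)
    · exact ht h
  obtain ⟨n, t, ht, e, he, hte⟩ := hπ.exists_eq_pow_mul hcQ
  have hte' := congrArg (algebraMap D K) hte
  simp only [map_mul, map_pow] at hte'
  refine ⟨n, ⟨e, he, ?_⟩, t * s, M.asIdeal.primeCompl.mul_mem ht hs, ?_⟩
  · convert FractionalIdeal.algebraMap_mul_mem t hc using 1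
    rw [hte', zpow_natCast]
    ring
  · convert FractionalIdeal.algebraMap_mul_mem e hb using 1
    have hπ0 : algebraMap D K π ^ n ≠ 0 := pow_ne_zero _ hπ.algebraMap_ne_zero
    rw [zpow_neg, zpow_natCast, map_mul, ← hcb]
    field_simp
    linear_combination b * hte'

/-- If the support of `u` contains no prime strictly below `M`, then `u D_M` is a power of the
maximal ideal of `D_M`. -/
theorem IsPruferDomain.exists_hasOrder [IsDomain D] (hD : IsPruferDomain D)
    (hπ : IsLocalUniformizer M π) (hu : ∀ P < M, P ∉ fractionalSupport (u : FractionalIdeal D⁰ K)) :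
    ∃ n, HasOrder M π u n := by
  obtain ⟨a, ha, b, hb, s, hs, hab⟩ := FractionalIdeal.exists_mul_eq_algebraMap u M
  obtain ⟨p, q, hq, rfl⟩ := IsFractionRing.div_surjective (A := D) a
  have hq0 : algebraMap D K q ≠ 0 := by simpa using nonZeroDivisors.ne_zero hq
  -- Either the local generator of `u` or its inverse belongs to `D_M`.
  obtain ⟨t, ht, ⟨c, hc⟩ | ⟨c, hc⟩⟩ := hD.exists_dvd_or_dvd M p q
  · have hc' := congrArg (algebraMap D K) hc
    rw [map_mul, map_mul] at hc'
    have hta : algebraMap D K t = algebraMap D K c * (algebraMap D K p / algebraMap D K q) := by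
      field_simp
      linear_combination hc'
    have htb : algebraMap D K t * b = algebraMap D K (c * s) := by
      rw [hta, mul_assoc, hab, map_mul]
    obtain ⟨n, hn⟩ := exists_hasOrder_of_algebraMap_mem (u := u⁻¹) hπ
      (fun P hP h => hu P hP (fractionalSupport_inv u h))
      (htb ▸ FractionalIdeal.algebraMap_mul_mem t hb) (by rwa [inv_inv])
      (M.asIdeal.primeCompl.mul_mem ht hs)
      (by rw [← htb, mul_assoc, mul_comm b, hab, map_mul])
    exact ⟨-n, by simpa using hn.inv⟩
  · have hc' := congrArg (algebraMap D K) hc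
    rw [map_mul, map_mul] at hc'
    have hta : algebraMap D K c = algebraMap D K t * (algebraMap D K p / algebraMap D K q) := by
      field_simp
      linear_combination -hc'
    exact exists_hasOrder_of_algebraMap_mem hπ hu
      (hta ▸ FractionalIdeal.algebraMap_mul_mem t ha) hb
      (M.asIdeal.primeCompl.mul_mem ht hs) (by rw [hta, mul_assoc, hab, map_mul])

theorem HasOrder.eq_one_of_isRadical (hπ : IsLocalUniformizer M π) {R : Ideal D}
    (hR : R.IsRadical) (hRM : R ≤ M.asIdeal)
    (huR : (u : FractionalIdeal D⁰ K) = (R : FractionalIdeal D⁰ K)) (hu : HasOrder M π u n) :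
    n = 1 := by
  have mem_iff : ∀ d : D, algebraMap D K d ∈ (u : FractionalIdeal D⁰ K) ↔ d ∈ R := by
    intro d
    rw [huR, FractionalIdeal.mem_coeIdeal]
    exact ⟨fun ⟨d', hd', h⟩ => IsFractionRing.injective D K h ▸ hd', fun h => ⟨d, h, rfl⟩⟩
  have hπ0 : algebraMap D K π ≠ 0 := hπ.algebraMap_ne_zero
  obtain ⟨⟨s, hs, hsu⟩, t, ht, htu⟩ := hu
  rcases le_or_gt n 0 with hn | hn
  · obtain ⟨k, hk⟩ := Int.exists_eq_neg_ofNat hn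
    refine absurd (hRM ((mem_iff s).mp ?_)) hs
    convert FractionalIdeal.algebraMap_mul_mem (π ^ k) hsu using 1
    rw [hk, zpow_neg, zpow_natCast, map_pow]
    field_simp
  · obtain ⟨k, rfl⟩ := Int.exists_add_of_le (Int.add_one_le_of_lt hn)
    have hsπ : s * π ∈ R := by
      refine hR ⟨k + 1, (mem_iff _).mp ?_⟩
      convert FractionalIdeal.algebraMap_mul_mem (s ^ k) hsu using 1
      have : (0 + 1 + k : ℤ) = ((k + 1 : ℕ) : ℤ) := by push_cast; ring
      rw [this, zpow_natCast, map_pow, map_pow, map_mul]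
      ring
    obtain ⟨d, hd⟩ := FractionalIdeal.exists_algebraMap_eq_mul u ((mem_iff _).mpr hsπ) htu
    cases k with
    | zero => simp
    | succ k =>
      have h1 : s * t = π * (π ^ k * d) := by
        apply IsFractionRing.injective D K
        simp only [map_mul, map_pow, hd]
        have : (0 + 1 + (k + 1 : ℕ) : ℤ) = ((k + 2 : ℕ) : ℤ) := by push_cast; ring
        rw [this, zpow_neg, zpow_natCast]
        field_simp
        ring
      have h2 : s * t ∉ M.asIdeal := M.asIdeal.primeCompl.mul_mem hs ht
      exact absurd (h1 ▸ Ideal.mul_mem_right _ _ hπ.mem) h2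

end Order

/-! ### The inverse topology -/

section InverseTopology

variable {R : Type*} [CommRing R]

/-- Neighbourhoods in the inverse topology contain a basic neighbourhood: finite intersections of
the subbasic sets `V(I)` are again of this form. -/
theorem exists_fg_le_of_mem_nhds_inverseTopology {P : PrimeSpectrum R}
    {U : Set (PrimeSpectrum R)} (hU : U ∈ @nhds _ (inverseTopology R) P) :
    ∃ J : Ideal R, J.FG ∧ J ≤ P.asIdeal ∧ ∀ Q : PrimeSpectrum R, J ≤ Q.asIdeal → Q ∈ U := by
  let _ := inverseTopology R
  obtain ⟨V, hVU, hV, hPV⟩ := mem_nhds_iff.mp hU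
  suffices h : ∃ J : Ideal R, J.FG ∧ J ≤ P.asIdeal ∧
      ∀ Q : PrimeSpectrum R, J ≤ Q.asIdeal → Q ∈ V by
    obtain ⟨J, h1, h2, h3⟩ := h
    exact ⟨J, h1, h2, fun Q hQ => hVU (h3 Q hQ)⟩
  clear hVU hU U
  induction hV with
  | basic s hs =>
    obtain ⟨I, hI, rfl⟩ := hs
    exact ⟨I, hI, hPV, fun Q hQ => hQ⟩
  | univ => exact ⟨⊥, Submodule.fg_bot, bot_le, fun Q _ => Set.mem_univ Q⟩
  | inter s t _ _ h1 h2 =>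
    obtain ⟨I, hI, hIP, hIs⟩ := h1 hPV.1
    obtain ⟨J, hJ, hJP, hJt⟩ := h2 hPV.2
    exact ⟨I ⊔ J, Submodule.FG.sup hI hJ, sup_le hIP hJP, fun Q hQ =>
      ⟨hIs Q (le_sup_left.trans hQ), hJt Q (le_sup_right.trans hQ)⟩⟩
  | sUnion S _ ih =>
    obtain ⟨s, hs, hPs⟩ := hPV
    obtain ⟨J, hJ, hJP, hJs⟩ := ih s hs hPs
    exact ⟨J, hJ, hJP, fun Q hQ => ⟨s, hs, hJs Q hQ⟩⟩

/-- Zariski closed sets are compact in the inverse topology: an ultrafilter converges to the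
prime ideal of the elements that are eventually contained in `P`. -/
theorem isCompact_zeroLocus_inverseTopology (A : Set R) :
    @IsCompact _ (inverseTopology R) (PrimeSpectrum.zeroLocus A) := by
  let _ := inverseTopology R
  rw [isCompact_iff_ultrafilter_le_nhds]
  intro F hF
  let Q : Ideal R :=
    { carrier := {d | ∀ᶠ P : PrimeSpectrum R in F, d ∈ P.asIdeal}
      zero_mem' := Filter.Eventually.of_forall fun P => zero_mem _
      add_mem' := fun hx hy => by
        filter_upwards [hx, hy] with P h1 h2 using add_mem h1 h2
      smul_mem' := fun c x hx => by
        filter_upwards [hx] with P h using Ideal.mul_mem_left _ c h }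
  have hQ : Q.IsPrime :=
    { ne_top' := by
        intro h
        have h1 : (1 : R) ∈ Q := h ▸ Submodule.mem_top
        obtain ⟨P, hP⟩ := Filter.Eventually.exists (f := (F : Filter (PrimeSpectrum R))) h1
        exact P.2.one_notMem hP
      mem_or_mem' := by
        intro x y hxy
        have hxy' : ∀ᶠ P : PrimeSpectrum R in F, x * y ∈ P.asIdeal := hxy
        exact Ultrafilter.eventually_or.mp (hxy'.mono fun P hP => P.2.mem_or_mem hP) }
  refine ⟨⟨Q, hQ⟩, fun a ha => ?_, ?_⟩
  · filter_upwards [Filter.le_principal_iff.mp hF] with P hP using hP ha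
  · rw [TopologicalSpace.nhds_generateFrom, le_iInf₂_iff]
    rintro _ ⟨hmem, I, ⟨S, rfl⟩, rfl⟩
    rw [Filter.le_principal_iff]
    have h : ∀ᶠ P : PrimeSpectrum R in F, ∀ x ∈ S, x ∈ P.asIdeal :=
      (Filter.eventually_all_finset S).mpr fun x hx => hmem (Ideal.subset_span hx)
    filter_upwards [h] with P hP
    rw [PrimeSpectrum.zeroLocus_span]
    exact hP

variable {X : Set (PrimeSpectrum R)}

theorem InverseSubspace.isInducing_val :
    @Topology.IsInducing _ _ _ (inverseTopology R) (fun P : InverseSubspace X => P.1) :=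
  @Topology.IsInducing.mk _ _ _ (inverseTopology R) _ rfl

theorem InverseSubspace.setOf_le_mem_nhds {J : Ideal R} (hJ : J.FG) {M : InverseSubspace X}
    (hM : J ≤ M.1.asIdeal) : {N : InverseSubspace X | J ≤ N.1.asIdeal} ∈ 𝓝 M := by
  let _ := inverseTopology R
  refine IsOpen.mem_nhds ?_ hM
  exact isOpen_induced (s := PrimeSpectrum.zeroLocus (J : Set R))
    (TopologicalSpace.isOpen_generateFrom_of_mem ⟨J, hJ, rfl⟩)

theorem InverseSubspace.exists_fg_le_of_mem_nhds {M : InverseSubspace X}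
    {U : Set (InverseSubspace X)} (hU : U ∈ 𝓝 M) :
    ∃ J : Ideal R, J.FG ∧ J ≤ M.1.asIdeal ∧
      ∀ N : InverseSubspace X, J ≤ N.1.asIdeal → N ∈ U := by
  let _ := inverseTopology R
  rw [InverseSubspace.isInducing_val.nhds_eq_comap] at hU
  obtain ⟨V, hV, hVU⟩ := hU
  obtain ⟨J, hJ, hJM, h⟩ := exists_fg_le_of_mem_nhds_inverseTopology hV
  exact ⟨J, hJ, hJM, fun N hN => hVU (h N.1 hN)⟩

/-- On a set of maximal ideals, the Zariski open sets are also open in the inverse topology: if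
`d ∉ M` then `d` is invertible modulo some `m ∈ M`, so `V(m)` avoids `V(d)`. -/
theorem InverseSubspace.setOf_notMem_mem_nhds {d : R} {M : InverseSubspace X}
    (hMax : M.1.asIdeal.IsMaximal) (hd : d ∉ M.1.asIdeal) :
    {N : InverseSubspace X | d ∉ N.1.asIdeal} ∈ 𝓝 M := by
  obtain ⟨r, m, hm, hrm⟩ := hMax.exists_inv hd
  have h := InverseSubspace.setOf_le_mem_nhds (J := Ideal.span {m})
    (Submodule.fg_span_singleton m) (M := M) (by simpa [Ideal.span_le] using hm)
  filter_upwards [h] with N hN hdN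
  refine N.1.2.one_notMem (hrm ▸ add_mem (Ideal.mul_mem_left _ _ hdN) (hN ?_))
  exact Ideal.mem_span_singleton_self m

theorem InverseSubspace.isCompact_setOf_mem {A : Set R} (hA : PrimeSpectrum.zeroLocus A ⊆ X) :
    IsCompact {N : InverseSubspace X | N.1 ∈ PrimeSpectrum.zeroLocus A} := by
  let _ := inverseTopology R
  rw [InverseSubspace.isInducing_val.isCompact_iff]
  convert isCompact_zeroLocus_inverseTopology A using 1
  ext P
  constructor
  · rintro ⟨N, hN, rfl⟩
    exact hN
  · exact fun hP => ⟨⟨P, hA hP⟩, hP, rfl⟩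

end InverseTopology

/-! ### Continuous functions with compact support generated by indicators -/

section IndicatorGroup

/-- Let `H` be a group of integer-valued functions that is closed under minima and contains the
indicators of arbitrarily small neighbourhoods of every point. Then `H` contains all continuous
functions with compact support. -/
theorem AddSubgroup.mem_of_hasCompactSupport {Y : Type*} [TopologicalSpace Y]
    (H : AddSubgroup (Y → ℤ)) (hinf : ∀ f ∈ H, ∀ g ∈ H, f ⊓ g ∈ H)
    (hnhds : ∀ y, ∀ U ∈ 𝓝 y, ∃ A ⊆ U, A ∈ 𝓝 y ∧ A.indicator 1 ∈ H)
    {f : Y → ℤ} (hf : Continuous f) (hc : HasCompactSupport f) : f ∈ H := by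
  classical
  have hinter : ∀ A B : Set Y, A.indicator 1 ∈ H → B.indicator 1 ∈ H →
      (A ∩ B).indicator 1 ∈ H := by
    intro A B hA hB
    convert hinf _ hA _ hB using 1
    ext y
    by_cases h1 : y ∈ A <;> by_cases h2 : y ∈ B <;> simp [h1, h2]
  have hunion : ∀ A B : Set Y, ∀ g : Y → ℤ, A.indicator g ∈ H → B.indicator g ∈ H →
      (A ∩ B).indicator g ∈ H → (A ∪ B).indicator g ∈ H := by
    intro A B g hA hB hAB
    convert sub_mem (add_mem hA hB) hAB using 1
    rw [← Set.indicator_union_add_inter, add_sub_cancel_right]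
  -- The sets covered by some `A` such that `f` times any indicator in `H` below `A` lies in `H`
  -- are stable under finite unions.
  obtain ⟨A, hA, hsub, h⟩ : ∃ A : Set Y, A.indicator 1 ∈ H ∧ tsupport f ⊆ A ∧
      ∀ B ⊆ A, B.indicator 1 ∈ H → B.indicator f ∈ H := by
    refine IsCompact.induction_on (p := fun s => ∃ A : Set Y, A.indicator 1 ∈ H ∧ s ⊆ A ∧
      ∀ B ⊆ A, B.indicator 1 ∈ H → B.indicator f ∈ H) hc ?_ ?_ ?_ ?_
    · refine ⟨∅, ?_, subset_rfl, fun B hB _ => ?_⟩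
      · rw [Set.indicator_empty']
        exact zero_mem H
      · rw [Set.subset_empty_iff.mp hB, Set.indicator_empty']
        exact zero_mem H
    · rintro s t hst ⟨A, hA, htA, h⟩
      exact ⟨A, hA, hst.trans htA, h⟩
    · rintro s t ⟨A, hA, hsA, h1⟩ ⟨B, hB, htB, h2⟩
      refine ⟨A ∪ B, hunion A B 1 hA hB (hinter A B hA hB),
        Set.union_subset_union hsA htB, fun C hC hCH => ?_⟩
      rw [← Set.inter_eq_left.mpr hC, Set.inter_union_distrib_left]
      refine hunion _ _ f (h1 _ Set.inter_subset_right (hinter C A hCH hA))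
        (h2 _ Set.inter_subset_right (hinter C B hCH hB))
        (h1 _ (Set.inter_subset_left.trans Set.inter_subset_right) ?_)
      exact hinter _ _ (hinter C A hCH hA) (hinter C B hCH hB)
    · intro y _
      have hU : f ⁻¹' {f y} ∈ 𝓝 y :=
        hf.continuousAt.preimage_mem_nhds ((isOpen_discrete _).mem_nhds rfl)
      obtain ⟨A, hAU, hAy, hA⟩ := hnhds y _ hU
      refine ⟨A, mem_nhdsWithin_of_mem_nhds hAy, A, hA, subset_rfl, fun B hB hBH => ?_⟩
      convert zsmul_mem hBH (f y) using 1
      ext z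
      by_cases hz : z ∈ B
      · have : f z = f y := hAU (hB hz)
        simp [hz, this]
      · simp [hz]
  have := h A subset_rfl hA
  rwa [Set.indicator_eq_self.mpr ((subset_tsupport f).trans hsub)] at this

end IndicatorGroup

/-! ### The order homomorphism on `Inv_X(D)` -/

section OrderHom

variable {D K : Type*} [CommRing D] [IsDomain D] [Field K] [Algebra D K] [IsFractionRing D K]

theorem fractionalSupport_eq_zeroLocus {u : (FractionalIdeal D⁰ K)ˣ} {I : Ideal D}
    (hu : (u : FractionalIdeal D⁰ K) = (I : FractionalIdeal D⁰ K)) :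
    fractionalSupport (u : FractionalIdeal D⁰ K) = PrimeSpectrum.zeroLocus (I : Set D) := by
  ext P
  rw [← not_iff_not, notMem_fractionalSupport_iff, hu]
  constructor
  · rintro ⟨⟨s, hs, hsu⟩, -⟩ hIP
    obtain ⟨d, hd, hds⟩ := (FractionalIdeal.mem_coeIdeal _).mp hsu
    exact hs (hIP (IsFractionRing.injective D K hds ▸ hd))
  · intro h
    obtain ⟨s, hsI, hs⟩ := Set.not_subset.mp h
    refine ⟨⟨s, hs, FractionalIdeal.mem_coeIdeal_of_mem _ hsI⟩, 1, P.2.one_notMem, ?_⟩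
    rw [FractionalIdeal.mem_units_inv_iff, hu]
    intro y hy
    obtain ⟨d, -, rfl⟩ := (FractionalIdeal.mem_coeIdeal _).mp hy
    exact ⟨d, by simp⟩

theorem exists_fractionalSupport_eq_zeroLocus (u : (FractionalIdeal D⁰ K)ˣ) :
    ∃ A : Set D, fractionalSupport (u : FractionalIdeal D⁰ K) = PrimeSpectrum.zeroLocus A := by
  let I (v : (FractionalIdeal D⁰ K)ˣ) : Ideal D :=
    Submodule.comap (Algebra.linearMap D K) ((v : FractionalIdeal D⁰ K) : Submodule D K)
  refine ⟨(I u * I u⁻¹ : Ideal D), ?_⟩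
  ext P
  rw [PrimeSpectrum.zeroLocus_mul, ← not_iff_not, notMem_fractionalSupport_iff, Set.mem_union,
    not_or, PrimeSpectrum.mem_zeroLocus, PrimeSpectrum.mem_zeroLocus, Set.not_subset,
    Set.not_subset]
  refine and_congr ?_ ?_ <;>
  exact exists_congr fun s => and_comm

theorem HasOrder.le_of_le {M : PrimeSpectrum D} {π : D} (hπ : IsLocalUniformizer M π)
    {u v : (FractionalIdeal D⁰ K)ˣ} {m n : ℤ} (hu : HasOrder M π u m) (hv : HasOrder M π v n)
    (huv : (u : FractionalIdeal D⁰ K) ≤ v) : n ≤ m := by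
  have h := hu.add hπ hv (w := v) (by rw [← FractionalIdeal.sup_eq_add, sup_eq_right.mpr huv])
  exact min_eq_right_iff.mp (h.unique hπ hv)

variable {X : Set (PrimeSpectrum D)} {π : InverseSubspace X → D}

/-- The map sending `u` to the family of its orders at the points of `X`, as a homomorphism. -/
theorem exists_orderHom (hD : IsPruferDomain D) (hMax : ∀ P ∈ X, P.asIdeal.IsMaximal)
    (hπ : ∀ M, IsLocalUniformizer M.1 (π M)) :
    ∃ ν : Additive (invX K X) →+ (InverseSubspace X → ℤ),
      ∀ u M, HasOrder M.1 (π M) (u.toMul : (FractionalIdeal D⁰ K)ˣ) (ν u M) := by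
  have h : ∀ (u : Additive (invX K X)) (M : InverseSubspace X),
      ∃ n, HasOrder M.1 (π M) (u.toMul : (FractionalIdeal D⁰ K)ˣ) n := by
    refine fun u M => hD.exists_hasOrder (hπ M) fun P hP hPu => ?_
    have hPM : P.asIdeal = M.1.asIdeal :=
      (hMax P (u.toMul.2 hPu)).eq_of_le M.1.2.ne_top hP.le
    exact hP.ne (PrimeSpectrum.ext hPM)
  choose ν hν using h
  refine ⟨AddMonoidHom.mk' ν fun u v => ?_, hν⟩
  ext M
  exact (hν (u + v) M).unique (hπ M) ((hν u M).mul (hπ M) (hν v M))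

theorem exists_isRadical_of_criticalSet_eq_empty (hcrit : criticalSet K X = ∅)
    (M : InverseSubspace X) :
    ∃ R : Ideal D, R.IsRadical ∧ R.FG ∧ R ≤ M.1.asIdeal ∧
      ∃ r ∈ invX K X, (r : FractionalIdeal D⁰ K) = (R : FractionalIdeal D⁰ K) := by
  obtain ⟨R, hR, hRM, r, hrX, hrR⟩ : ∃ R : Ideal D, R.IsRadical ∧ R ≤ M.1.asIdeal ∧
      ∃ r ∈ invX K X, (r : FractionalIdeal D⁰ K) = (R : FractionalIdeal D⁰ K) := by
    by_contra h
    exact Set.notMem_empty M.1 (hcrit ▸ ⟨M.2, h⟩)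
  exact ⟨R, hR, Ideal.fg_of_isUnit (IsFractionRing.injective D K) R (hrR ▸ r.isUnit), hRM,
    r, hrX, hrR⟩

variable {ν : Additive (invX K X) →+ (InverseSubspace X → ℤ)}

theorem orderHom_eq_zero_iff (hπ : ∀ M, IsLocalUniformizer M.1 (π M))
    (hν : ∀ u M, HasOrder M.1 (π M) (u.toMul : (FractionalIdeal D⁰ K)ˣ) (ν u M))
    (u : Additive (invX K X)) (M : InverseSubspace X) :
    ν u M = 0 ↔ M.1 ∉ fractionalSupport
      ((u.toMul : (FractionalIdeal D⁰ K)ˣ) : FractionalIdeal D⁰ K) := by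
  rw [← hasOrder_zero_iff (π := π M)]
  exact ⟨fun h => h ▸ hν u M, fun h => (hν u M).unique (hπ M) h⟩

theorem orderHom_injective (hπ : ∀ M, IsLocalUniformizer M.1 (π M))
    (hν : ∀ u M, HasOrder M.1 (π M) (u.toMul : (FractionalIdeal D⁰ K)ˣ) (ν u M)) :
    Function.Injective ν := by
  refine (injective_iff_map_eq_zero ν).mpr fun u hu => ?_
  have hsupp : fractionalSupport
      ((u.toMul : (FractionalIdeal D⁰ K)ˣ) : FractionalIdeal D⁰ K) = ∅ := by
    refine Set.eq_empty_iff_forall_notMem.mpr fun P hP => ?_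
    have hPX : P ∈ X := u.toMul.2 hP
    exact (orderHom_eq_zero_iff hπ hν u ⟨P, hPX⟩).mp (congrFun hu _) hP
  have h : u.toMul = 1 := Subtype.ext (eq_one_of_fractionalSupport_eq_empty hsupp)
  exact Additive.toMul.injective h

/-- Dividing `u` by a power of a radical ideal below `M` makes its order at `M` zero, and a
fractional ideal that is trivial at `M` is trivial at all `N ∈ X` not containing a fixed element
of `D \ M`. So the orders of `u` are locally constant. -/
theorem continuous_orderHom (hMax : ∀ P ∈ X, P.asIdeal.IsMaximal)
    (hcrit : criticalSet K X = ∅) (hπ : ∀ M, IsLocalUniformizer M.1 (π M))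
    (hν : ∀ u M, HasOrder M.1 (π M) (u.toMul : (FractionalIdeal D⁰ K)ˣ) (ν u M))
    (u : Additive (invX K X)) : Continuous (ν u) := by
  refine (IsLocallyConstant.iff_eventually_eq _).mpr (fun M => ?_) |>.continuous
  obtain ⟨R, hR, hRfg, hRM, r, hrX, hrR⟩ := exists_isRadical_of_criticalSet_eq_empty hcrit M
  let r' : Additive (invX K X) := Additive.ofMul ⟨r, hrX⟩
  have hr' : ∀ N : InverseSubspace X, R ≤ N.1.asIdeal → ν r' N = 1 := fun N hN =>
    (hν r' N).eq_one_of_isRadical (hπ N) hR hN hrR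
  have hval : ∀ N : InverseSubspace X, R ≤ N.1.asIdeal →
      ν (u - ν u M • r') N = ν u N - ν u M := by
    intro N hN
    simp [hr' N hN]
  have h0 : ν (u - ν u M • r') M = 0 := by rw [hval M hRM, sub_self]
  obtain ⟨⟨s, hs, hsu⟩, t, ht, htu⟩ :=
    (notMem_fractionalSupport_iff _ _).mp ((orderHom_eq_zero_iff hπ hν _ M).mp h0)
  filter_upwards [InverseSubspace.setOf_le_mem_nhds hRfg hRM,
    InverseSubspace.setOf_notMem_mem_nhds (hMax M.1 M.2) hs,
    InverseSubspace.setOf_notMem_mem_nhds (hMax M.1 M.2) ht] with N h1 h2 h3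
  have h4 := (orderHom_eq_zero_iff hπ hν _ N).mpr
    ((notMem_fractionalSupport_iff _ _).mpr ⟨⟨s, h2, hsu⟩, t, h3, htu⟩)
  rw [hval N h1] at h4
  exact sub_eq_zero.mp h4

theorem hasCompactSupport_orderHom (hπ : ∀ M, IsLocalUniformizer M.1 (π M))
    (hν : ∀ u M, HasOrder M.1 (π M) (u.toMul : (FractionalIdeal D⁰ K)ˣ) (ν u M))
    {u : Additive (invX K X)} (hu : Continuous (ν u)) : HasCompactSupport (ν u) := by
  obtain ⟨A, hA⟩ := exists_fractionalSupport_eq_zeroLocus (u.toMul : (FractionalIdeal D⁰ K)ˣ)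
  have hclosed : IsClosed (Function.support (ν u)) :=
    ((isClosed_discrete ({0}ᶜ : Set ℤ)).preimage hu)
  rw [HasCompactSupport, tsupport, hclosed.closure_eq]
  convert InverseSubspace.isCompact_setOf_mem (X := X) (A := A) (hA ▸ u.toMul.2) using 1
  ext N
  rw [Function.mem_support, ne_eq, orderHom_eq_zero_iff hπ hν, not_not, hA]
  rfl

theorem IsPruferDomain.inf_mem_range_orderHom (hD : IsPruferDomain D)
    (hπ : ∀ M, IsLocalUniformizer M.1 (π M))
    (hν : ∀ u M, HasOrder M.1 (π M) (u.toMul : (FractionalIdeal D⁰ K)ˣ) (ν u M))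
    (u v : Additive (invX K X)) : ν u ⊓ ν v ∈ ν.range := by
  obtain ⟨w, hw⟩ := hD.isUnit_add (u.toMul : (FractionalIdeal D⁰ K)ˣ) v.toMul
  have hwX : w ∈ invX K X :=
    (fractionalSupport_add_subset hw).trans (Set.union_subset u.toMul.2 v.toMul.2)
  refine ⟨Additive.ofMul ⟨w, hwX⟩, ?_⟩
  ext M
  exact (hν _ M).unique (hπ M) ((hν u M).add (hπ M) (hν v M) hw)

/-- A finitely generated ideal `I` containing a radical ideal of `Inv_X(D)` has order at most one
at each point of `X`, so its orders form the indicator function of `V(I)`. -/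
theorem IsPruferDomain.exists_indicator_mem_range_orderHom (hD : IsPruferDomain D)
    (hcrit : criticalSet K X = ∅) (hπ : ∀ M, IsLocalUniformizer M.1 (π M))
    (hν : ∀ u M, HasOrder M.1 (π M) (u.toMul : (FractionalIdeal D⁰ K)ˣ) (ν u M))
    (M : InverseSubspace X) {U : Set (InverseSubspace X)} (hU : U ∈ 𝓝 M) :
    ∃ A ⊆ U, A ∈ 𝓝 M ∧ A.indicator 1 ∈ ν.range := by
  classical
  obtain ⟨R, hR, hRfg, hRM, r, hrX, hrR⟩ := exists_isRadical_of_criticalSet_eq_empty hcrit M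
  obtain ⟨J, hJfg, hJM, hJU⟩ := InverseSubspace.exists_fg_le_of_mem_nhds hU
  have hIfg : (J ⊔ R).FG := Submodule.FG.sup hJfg hRfg
  have hRI : (R : FractionalIdeal D⁰ K) ≤ ((J ⊔ R : Ideal D) : FractionalIdeal D⁰ K) :=
    (FractionalIdeal.coeIdeal_le_coeIdeal K).mpr le_sup_right
  obtain ⟨w, hw⟩ : IsUnit ((J ⊔ R : Ideal D) : FractionalIdeal D⁰ K) := by
    refine hD.isUnit_of_fg (fun h => ?_)
      ((FractionalIdeal.coeIdeal_fg D⁰ (IsFractionRing.injective D K) _).mpr hIfg)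
    rw [h, ← hrR] at hRI
    exact r.ne_zero (le_antisymm hRI zero_le)
  have hwX : w ∈ invX K X := by
    have hsub : fractionalSupport (w : FractionalIdeal D⁰ K) ⊆
        fractionalSupport (r : FractionalIdeal D⁰ K) := by
      rw [fractionalSupport_eq_zeroLocus hw, fractionalSupport_eq_zeroLocus hrR]
      exact PrimeSpectrum.zeroLocus_anti_mono_ideal le_sup_right
    exact hsub.trans hrX
  refine ⟨{N | J ⊔ R ≤ N.1.asIdeal}, fun N hN => hJU N (le_sup_left.trans hN),
    InverseSubspace.setOf_le_mem_nhds hIfg (sup_le hJM hRM), Additive.ofMul ⟨w, hwX⟩, ?_⟩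
  ext N
  have hN := hν (Additive.ofMul ⟨w, hwX⟩) N
  have h0 := orderHom_eq_zero_iff hπ hν (Additive.ofMul ⟨w, hwX⟩) N
  rw [toMul_ofMul, fractionalSupport_eq_zeroLocus hw] at h0
  by_cases hIN : J ⊔ R ≤ N.1.asIdeal
  · rw [Set.indicator_of_mem (by exact hIN), Pi.one_apply]
    have hr := hν (Additive.ofMul ⟨r, hrX⟩) N
    have hr1 := hr.eq_one_of_isRadical (hπ N) hR (le_sup_right.trans hIN) hrR
    have hle := hr.le_of_le (hπ N) hN (by rw [toMul_ofMul, toMul_ofMul, hrR, hw]; exact hRI)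
    have hge := hN.le_of_le (hπ N) (v := 1) (n := 0)
      (hasOrder_zero_iff.mpr (by simp [fractionalSupport_one]))
      (by rw [toMul_ofMul, hw, Units.val_one]; exact FractionalIdeal.coeIdeal_le_one)
    have hne : ν (Additive.ofMul ⟨w, hwX⟩) N ≠ 0 := fun h => h0.mp h hIN
    omega
  · rw [Set.indicator_of_notMem (by exact hIN)]
    exact h0.mpr hIN

end OrderHom

theorem mainTheorem6 {D K : Type*} [CommRing D] [IsDomain D] [Field K] [Algebra D K]
    [IsFractionRing D K] (hD : IsPruferDomain D) (X : Set (PrimeSpectrum D))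
    (hMax : ∀ P ∈ X, P.asIdeal.IsMaximal) (hX : IsDiscreteSplittingSet X)
    (hcrit : criticalSet K X = ∅) :
    Nonempty (Additive (invX K X) ≃+ C_c(InverseSubspace X, ℤ)) := by
  have hunif : ∀ M : InverseSubspace X, ∃ π, IsLocalUniformizer M.1 π := fun M =>
    hD.exists_isLocalUniformizer (hMax M.1 M.2) (hX.not_idempotent M.1 M.2)
  choose π hπ using hunif
  obtain ⟨ν, hν⟩ := exists_orderHom (K := K) hD hMax hπ
  have hcont := continuous_orderHom hMax hcrit hπ hν
  let φ : Additive (invX K X) →+ C_c(InverseSubspace X, ℤ) :=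
    AddMonoidHom.mk' (fun u => ⟨⟨ν u, hcont u⟩, hasCompactSupport_orderHom hπ hν (hcont u)⟩)
      fun u v => DFunLike.ext _ _ fun M => congrFun (map_add ν u v) M
  refine ⟨AddEquiv.ofBijective φ ⟨fun u v huv => ?_, fun f => ?_⟩⟩
  · exact orderHom_injective hπ hν (congrArg DFunLike.coe huv)
  · obtain ⟨u, hu⟩ : ⇑f ∈ ν.range := by
      refine ν.range.mem_of_hasCompactSupport ?_
        (fun M U hU => hD.exists_indicator_mem_range_orderHom hcrit hπ hν M hU)
        f.continuous f.hasCompactSupport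
      rintro _ ⟨u, rfl⟩ _ ⟨v, rfl⟩
      exact hD.inf_mem_range_orderHom hπ hν u v
    exact ⟨u, DFunLike.ext _ _ fun M => congrFun hu M⟩
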